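/- Let $G$ be a finite simple connected graph with vertex set $V$ and graph distance $d_G$, and let $k\ge 1$. A set $W\subseteq V$ is a \emph{resolving set} if for any two distinct vertices $x,y\in V\setminus W$ there is $w\in W$ with $d_G(x,w)\ne d_G(y,w)$; a set $D\subseteq V$ is a \emph{distance $k$-dominating set} if every vertex of $V\setminus D$ is at distance at most $k$ from some vertex of $D$. Let $\dim(G)$, $\gamma_k(G)$ and $\gamma^r_k(G)$ denote the minimum cardinality of, respectively, a resolving set, a distance $k$-dominating set, and a set that is both resolving and distance $k$-dominating. \textbf{Theorem.} Fix an integer $k\ge 2$. (a) For all positive integers $\beta,\gamma,\alpha$ with $\max\{\gamma,\beta\}\le\alpha\le\gamma+\beta$ and $(\beta,\gamma,\alpha)\notin\{(1,\gamma,\gamma+1):\gamma\ge 2\}$ there is a finite tree $T$ with $\dim(T)=\beta$, $\gamma_k(T)=\gamma$ and $\gamma^r_k(T)=\alpha$. (b) For every integer $\gamma\ge 2$ there is no finite connected graph $G$ with $\dim(G)=1$, $\gamma_k(G)=\gamma$ and $\gamma^r_k(G)=\gamma+1$. -/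

import Mathlib

namespace SimpleGraph

variable {V : Type*}

/-- `W` is a resolving set of `G`: distinct vertices outside `W` have different vectors of
distances to the members of `W`. (`edist` is the usual graph distance, `⊤` when there is no
path.) -/
def IsResolvingSet (G : SimpleGraph V) (W : Finset V) : Prop :=
  ∀ x y : V, x ∉ W → y ∉ W → x ≠ y → ∃ w ∈ W, G.edist x w ≠ G.edist y w

/-- `D` is a distance `k`-dominating set of `G`: each vertex outside `D` is at distance at most
`k` from some member of `D`. -/
def IsDistDominatingSet (G : SimpleGraph V) (k : ℕ) (D : Finset V) : Prop :=
  ∀ v : V, v ∉ D → ∃ x ∈ D, G.edist v x ≤ (k : ℕ∞)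

/-- `S` is both a resolving set and a distance `k`-dominating set of `G`. -/
def IsDistResolvingDominatingSet (G : SimpleGraph V) (k : ℕ) (S : Finset V) : Prop :=
  G.IsResolvingSet S ∧ G.IsDistDominatingSet k S

/-- The metric dimension of `G`, the least size of a resolving set. (In this and the next two
definitions the set of sizes is nonempty for finite `V`, as the set of all vertices qualifies.) -/
noncomputable def metricDim (G : SimpleGraph V) : ℕ :=
  sInf {n | ∃ W : Finset V, G.IsResolvingSet W ∧ W.card = n}

/-- The distance `k`-domination number of `G`. -/
noncomputable def distDominationNumber (G : SimpleGraph V) (k : ℕ) : ℕ :=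
  sInf {n | ∃ D : Finset V, G.IsDistDominatingSet k D ∧ D.card = n}

/-- The distance `k`-resolving domination number of `G`. -/
noncomputable def distResolvingDominationNumber (G : SimpleGraph V) (k : ℕ) : ℕ :=
  sInf {n | ∃ S : Finset V, G.IsDistResolvingDominatingSet k S ∧ S.card = n}

end SimpleGraph

/-! ### Minimum sizes -/

/-! For (b), a graph of metric dimension 1 is a path, and any two vertices of a path resolve it. So
a dominating set of size at least 2 is already resolving
(`Connected.isResolvingSet_of_two_le_card`).

For (a) with `β = 1`, paths suffice. For `β ≥ 2`, combs are used: columns of height `k` or 1 joined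
at their feet, column `i` ending in `t i` sibling tips. Resolving costs `t i - 1` per column, as
only sibling tips separate each other. Dominating costs 1 per column of height `k` and nothing for a
column of height 1 next to one of these. Doing both costs `max (t i - 1) 1`, because a tip of a
column dominates that column. Hence `γ + β - α` counts the columns of height `k` with several tips,
and this number can be prescribed. -/

theorem sInf_card_eq {V : Type*} {P : Finset V → Prop} {m : ℕ}
    (hup : ∃ S, P S ∧ S.card ≤ m) (hlow : ∀ S, P S → m ≤ S.card) :
    sInf {n | ∃ S : Finset V, P S ∧ S.card = n} = m := by
  obtain ⟨S, hS, hc⟩ := hup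
  apply le_antisymm
  · refine le_trans (Nat.sInf_le ?_) hc
    exact ⟨S, hS, rfl⟩
  · obtain ⟨S', hS', h'⟩ := Nat.sInf_mem (s := {n | ∃ S : Finset V, P S ∧ S.card = n})
      ⟨S.card, S, hS, rfl⟩
    rw [← h']
    exact hlow _ hS'

/-! ### Recognizing distances and trees -/

namespace SimpleGraph

variable {V : Type*} {G : SimpleGraph V}

/-- A function satisfying the triangle inequality along edges, which can always be decreased
along some edge, is the graph distance. -/
theorem exists_walk_length_eq_of_descent {d : V → V → ℕ}
    (hdesc : ∀ x y, x ≠ y → ∃ x', G.Adj x x' ∧ d x' y + 1 = d x y) (h0 : ∀ x, d x x = 0)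
    (x y : V) : ∃ p : G.Walk x y, p.length = d x y := by
  induction hn : d x y generalizing x with
  | zero =>
    by_cases hxy : x = y
    · subst hxy; exact ⟨.nil, rfl⟩
    · obtain ⟨x', -, h⟩ := hdesc x y hxy; omega
  | succ m ih =>
    have hxy : x ≠ y := by rintro rfl; rw [h0] at hn; omega
    obtain ⟨x', ha, h⟩ := hdesc x y hxy
    obtain ⟨p, hp⟩ := ih x' (by omega)
    exact ⟨.cons ha p, by simp [hp]⟩

/-- Greedy descent gives a walk of length `d x y`; since `d` drops by at most one along an edge, no
walk is shorter. -/
theorem edist_eq_of_descent {d : V → V → ℕ} (h0 : ∀ x, d x x = 0)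
    (hadj : ∀ x y z, G.Adj x y → d x z ≤ d y z + 1)
    (hdesc : ∀ x y, x ≠ y → ∃ x', G.Adj x x' ∧ d x' y + 1 = d x y) (x y : V) :
    G.edist x y = d x y := by
  apply le_antisymm
  · obtain ⟨p, hp⟩ := exists_walk_length_eq_of_descent hdesc h0 x y
    rw [← hp]; exact edist_le p
  · have key : ∀ {x y : V} (p : G.Walk x y), d x y ≤ p.length := by
      intro x y p
      induction p with
      | nil => simp [h0]
      | cons h p ih => have := hadj _ _ _ h |>.trans (Nat.add_le_add_right ih 1); simpa using this
    refine le_iInf fun p => ?_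
    exact_mod_cast key p

theorem connected_of_descent [Nonempty V] {d : V → V → ℕ} (h0 : ∀ x, d x x = 0)
    (hdesc : ∀ x y, x ≠ y → ∃ x', G.Adj x x' ∧ d x' y + 1 = d x y) : G.Connected :=
  ⟨fun x y => ⟨(exists_walk_length_eq_of_descent hdesc h0 x y).choose⟩⟩

/-- A finite connected graph whose edges join non-root vertices to their parents is a tree. -/
theorem isTree_of_parent [Finite V] (hG : G.Connected) (r : V) (par : V → V)
    (h : ∀ x y, G.Adj x y → (x ≠ r ∧ par x = y) ∨ (y ≠ r ∧ par y = x)) : G.IsTree := by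
  classical
  rw [isTree_iff_connected_and_card]
  refine ⟨hG, le_antisymm ?_ hG.card_vert_le_card_edgeSet_add_one⟩
  -- Each edge is charged to its child endpoint, so there are at most as many edges as non-root
  -- vertices.
  have hsub : G.edgeSet ⊆ (fun v => s(v, par v)) '' {v | v ≠ r} := by
    intro e
    induction e with
    | _ x y =>
      intro he
      rcases h x y he with ⟨h1, rfl⟩ | ⟨h1, rfl⟩
      · exact ⟨x, h1, rfl⟩
      · exact ⟨y, h1, Sym2.eq_swap⟩
  have h1 : G.edgeSet.ncard ≤ {v | v ≠ r}.ncard :=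
    (Set.ncard_le_ncard hsub (Set.toFinite _)).trans (Set.ncard_image_le (Set.toFinite _))
  have h2 : {v | v ≠ r}.ncard + 1 = Nat.card V := by
    rw [← Set.ncard_univ V, ← Set.ncard_sdiff_singleton_add_one (Set.mem_univ r) (Set.toFinite _)]
    congr 2; ext; simp
  rw [Nat.card_coe_set_eq]; omega

/-! ### Graphs resolved by one vertex -/

theorem Reachable.exists_dist_eq_of_le {x w : V} (h : G.Reachable x w) {j : ℕ}
    (hj : j ≤ G.dist x w) : ∃ y, G.dist y w = j ∧ G.dist x y + j ≤ G.dist x w := by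
  obtain ⟨p, hp⟩ := h.exists_walk_length_eq_dist
  refine ⟨p.getVert (p.length - j), ?_⟩
  have h1 : G.dist x (p.getVert (p.length - j)) ≤ p.length - j :=
    (dist_le (p.take _)).trans (by simp)
  have h2 : G.dist (p.getVert (p.length - j)) w ≤ j :=
    (dist_le (p.drop _)).trans (by simp; omega)
  have h3 : G.dist x w ≤ _ := Reachable.dist_triangle_left (w := w) ⟨p.take (p.length - j)⟩
  exact ⟨by omega, by omega⟩

/-- In a connected graph resolved by one vertex, distances are differences of positions. -/
theorem Connected.dist_eq_of_injective (hG : G.Connected) {w : V}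
    (hw : Function.Injective fun x => G.dist x w) {x y : V} (hxy : G.dist y w ≤ G.dist x w) :
    G.dist x y = G.dist x w - G.dist y w := by
  obtain ⟨z, hz, hxz⟩ := (hG x w).exists_dist_eq_of_le hxy
  obtain rfl : z = y := hw hz
  have := hG.dist_triangle (u := x) (v := z) (w := w)
  omega

/-- Give each vertex its distance to `w` as position. A vertex equidistant from `x ≠ y` must have
the midpoint of their positions, which two members of `D` cannot share. -/
theorem Connected.isResolvingSet_of_two_le_card (hG : G.Connected) {w : V}
    (hw : Function.Injective fun x => G.dist x w) {D : Finset V} (hD : 2 ≤ D.card) :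
    G.IsResolvingSet D := by
  obtain ⟨u, hu, v, hv, huv⟩ := Finset.one_lt_card.1 hD
  intro x y _ _ hxy
  by_contra! hcon
  have key : ∀ a ∈ D, G.dist x a = G.dist y a := fun a ha => by simp only [dist, hcon a ha]
  have hd : ∀ a b, G.dist a b = (G.dist a w - G.dist b w) + (G.dist b w - G.dist a w) := by
    intro a b
    rcases le_total (G.dist b w) (G.dist a w) with h | h
    · rw [hG.dist_eq_of_injective hw h]; omega
    · rw [dist_comm, hG.dist_eq_of_injective hw h]; omega
  have h1 := key u hu
  have h2 := key v hv
  rw [hd x, hd y] at h1 h2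
  have h3 : G.dist x w ≠ G.dist y w := fun h => hxy (hw h)
  have h4 : G.dist u w ≠ G.dist v w := fun h => huv (hw h)
  omega

theorem Connected.exists_injective_dist_of_metricDim_eq_one (hG : G.Connected)
    (h : G.metricDim = 1) : ∃ w, Function.Injective fun x => G.dist x w := by
  -- The infimum of the empty set is 0, not 1.
  have hne : {n | ∃ W : Finset V, G.IsResolvingSet W ∧ W.card = n}.Nonempty := by
    by_contra hne
    rw [Set.not_nonempty_iff_eq_empty] at hne
    simp [metricDim, hne] at h
  obtain ⟨W, hW, hc⟩ := Nat.sInf_mem hne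
  obtain ⟨w, rfl⟩ := Finset.card_eq_one.1 (hc.trans h)
  refine ⟨w, fun x y hxy => ?_⟩
  by_contra hne
  have hxy : G.dist x w = G.dist y w := hxy
  -- Resolving says nothing about `w` itself, but only `w` is at distance 0 from `w`.
  by_cases hx : x = w
  · subst hx
    rw [dist_self] at hxy
    exact hne ((hG y x).dist_eq_zero_iff.1 hxy.symm).symm
  by_cases hy : y = w
  · subst hy
    rw [dist_self] at hxy
    exact hne ((hG x y).dist_eq_zero_iff.1 hxy)
  obtain ⟨w', hw', hd⟩ := hW x y (by simpa using hx) (by simpa using hy) hne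
  obtain rfl := Finset.mem_singleton.1 hw'
  apply hd
  rw [← (hG x w').coe_dist_eq_edist, ← (hG y w').coe_dist_eq_edist, hxy]

theorem Connected.distResolvingDominationNumber_le_of_metricDim_eq_one [Finite V]
    (hG : G.Connected) {k : ℕ}
    (h : G.metricDim = 1) (h2 : 2 ≤ G.distDominationNumber k) :
    G.distResolvingDominationNumber k ≤ G.distDominationNumber k := by
  obtain ⟨w, hw⟩ := hG.exists_injective_dist_of_metricDim_eq_one h
  have := Fintype.ofFinite V
  obtain ⟨D, hD, hc⟩ := Nat.sInf_mem
    (s := {n | ∃ D : Finset V, G.IsDistDominatingSet k D ∧ D.card = n})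
    ⟨_, Finset.univ, fun v hv => (hv (Finset.mem_univ v)).elim, rfl⟩
  have hc : D.card = G.distDominationNumber k := hc
  exact Nat.sInf_le ⟨D, ⟨hG.isResolvingSet_of_two_le_card hw (hc ▸ h2), hD⟩, hc⟩

end SimpleGraph

/-! ### Combs with branching tips -/

/-- The triples `(i, h, j)`: column `i < n`, height `h ≤ l i`, and an index `j`, which is
less than `t i` at the tip `h = l i` of the column and zero below it. -/
def combVerts (n : ℕ) (l t : ℕ → ℕ) : Finset (ℕ × ℕ × ℕ) :=
  (Finset.range n).biUnion fun i => (Finset.range (l i + 1)).biUnion fun h =>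
    (Finset.range (if h = l i then t i else 1)).image fun j => (i, h, j)

theorem mem_combVerts {n : ℕ} {l t : ℕ → ℕ} {i h j : ℕ} :
    (i, h, j) ∈ combVerts n l t ↔
      i < n ∧ h ≤ l i ∧ (h = l i → j < t i) ∧ (h ≠ l i → j = 0) := by
  simp only [combVerts, Finset.mem_biUnion, Finset.mem_range, Finset.mem_image, Prod.mk.injEq]
  constructor
  · rintro ⟨i, hi, h, hh, j, hj, rfl, rfl, rfl⟩
    split_ifs at hj <;> grind
  · rintro ⟨hi, hh, h1, h2⟩
    refine ⟨i, hi, h, by omega, j, ?_, rfl, rfl, rfl⟩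
    split_ifs <;> grind

/-- The distance in a comb: columns meet only at height zero, where consecutive ones are joined. -/
def combDist (x y : ℕ × ℕ × ℕ) : ℕ :=
  if x.1 = y.1 then
    if x.2.1 = y.2.1 then if x.2.2 = y.2.2 then 0 else 2
    else (x.2.1 - y.2.1) + (y.2.1 - x.2.1)
  else x.2.1 + y.2.1 + ((x.1 - y.1) + (y.1 - x.1))

theorem combDist_self (x : ℕ × ℕ × ℕ) : combDist x x = 0 := by simp [combDist]

theorem combDist_comm (x y : ℕ × ℕ × ℕ) : combDist x y = combDist y x := by
  obtain ⟨i, h, j⟩ := x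
  obtain ⟨i', h', j'⟩ := y
  simp only [combDist]
  split_ifs <;> omega

theorem combDist_triangle (x y z : ℕ × ℕ × ℕ) :
    combDist x z ≤ combDist x y + combDist y z := by
  obtain ⟨i, h, j⟩ := x
  obtain ⟨i', h', j'⟩ := y
  obtain ⟨i'', h'', j''⟩ := z
  simp only [combDist]
  split_ifs <;> omega

/-- The comb with `n` columns of heights `l i`, the `i`-th one with `t i` tips. -/
def comb (n : ℕ) (l t : ℕ → ℕ) : SimpleGraph (combVerts n l t) where
  Adj x y := combDist x y = 1
  symm := ⟨fun x y h => by rwa [combDist_comm]⟩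
  loopless := ⟨fun x h => by rw [combDist_self] at h; omega⟩

/-! ### Distances and lower bounds in combs -/

section

variable {n : ℕ} {l t : ℕ → ℕ}

/-- Height at least one keeps feet apart from tips, so each column has a single foot. -/
theorem comb_descent (hl : ∀ i, 1 ≤ l i)
    (x y : combVerts n l t) (hxy : x ≠ y) : ∃ x', (comb n l t).Adj x x' ∧
      combDist x' y + 1 = combDist x y := by
  obtain ⟨⟨i, h, j⟩, hx⟩ := x
  obtain ⟨⟨i', h', j'⟩, hy⟩ := y
  have hne : ¬ (i = i' ∧ h = h' ∧ j = j') := by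
    rintro ⟨rfl, rfl, rfl⟩; exact hxy rfl
  rw [mem_combVerts] at hx hy
  have hli := hl i
  have hli' := hl i'
  have main : ∃ a b c, (a, b, c) ∈ combVerts n l t ∧ combDist (i, h, j) (a, b, c) = 1 ∧
      combDist (a, b, c) (i', h', j') + 1 = combDist (i, h, j) (i', h', j') := by
    by_cases hi : i = i'
    · subst hi
      by_cases hh : h < h'
      · refine ⟨i, h + 1, if h + 1 = h' then j' else 0, ?_⟩
        rw [mem_combVerts]
        simp only [combDist]
        grind
      -- If `h = h'`, these are two sibling tips, and the vertex below them is their common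
      -- neighbour.
      · refine ⟨i, h - 1, 0, ?_⟩
        rw [mem_combVerts]
        simp only [combDist]
        grind
    · by_cases hh : h = 0
      · subst hh
        by_cases hlt : i < i'
        · refine ⟨i + 1, 0, 0, ?_⟩
          have := hl (i + 1)
          rw [mem_combVerts]
          simp only [combDist]
          grind
        · refine ⟨i - 1, 0, 0, ?_⟩
          have := hl (i - 1)
          rw [mem_combVerts]
          simp only [combDist]
          grind
      · refine ⟨i, h - 1, 0, ?_⟩
        rw [mem_combVerts]
        simp only [combDist]
        grind
  obtain ⟨a, b, c, hm, h1, h2⟩ := main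
  exact ⟨⟨(a, b, c), hm⟩, h1, h2⟩

theorem comb_edist (hl : ∀ i, 1 ≤ l i) (x y : combVerts n l t) :
    (comb n l t).edist x y = combDist x y := by
  refine SimpleGraph.edist_eq_of_descent (d := fun x y : combVerts n l t => combDist x y)
    (fun x => combDist_self _) (fun x y z h => ?_) (comb_descent hl) x y
  have h1 : combDist x y = 1 := h
  have := combDist_triangle x y z
  omega

theorem comb_isTree (hl : ∀ i, 1 ≤ l i) (hn : 1 ≤ n) : (comb n l t).IsTree := by
  have h0 : (0, 0, 0) ∈ combVerts n l t := by
    have := hl 0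
    rw [mem_combVerts]; grind
  have : Nonempty (combVerts n l t) := ⟨⟨_, h0⟩⟩
  have hpar : ∀ x : combVerts n l t,
      (if x.1.2.1 = 0 then (x.1.1 - 1, 0, 0) else (x.1.1, x.1.2.1 - 1, 0)) ∈
        combVerts n l t := by
    rintro ⟨⟨i, h, j⟩, hx⟩
    have := hl (i - 1)
    have := hl i
    rw [mem_combVerts] at hx
    split_ifs <;> rw [mem_combVerts] <;> grind
  refine SimpleGraph.isTree_of_parent
    (SimpleGraph.connected_of_descent (d := fun x y : combVerts n l t => combDist x y)
      (fun x => combDist_self _) (comb_descent hl)) ⟨_, h0⟩ (fun x => ⟨_, hpar x⟩) ?_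
  rintro ⟨⟨i, h, j⟩, hx⟩ ⟨⟨i', h', j'⟩, hy⟩ hadj
  have hadj : combDist (i, h, j) (i', h', j') = 1 := hadj
  have := hl i
  have := hl i'
  rw [mem_combVerts] at hx hy
  simp only [ne_eq, Subtype.mk.injEq, Prod.mk.injEq]
  simp only [combDist] at hadj
  grind

/-- A resolving set misses at most one tip of each column. -/
theorem comb_le_card_of_isResolvingSet (hl : ∀ i, 1 ≤ l i) {S : Finset (combVerts n l t)}
    (hS : (comb n l t).IsResolvingSet S) {i : ℕ} (hi : i < n) :
    t i - 1 ≤ (S.filter fun x => x.1.1 = i).card := by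
  classical
  let tip : Fin (t i) → combVerts n l t := fun j => ⟨(i, l i, j), by
    rw [mem_combVerts]; exact ⟨hi, le_rfl, fun _ => j.2, fun h => (h rfl).elim⟩⟩
  have htip : Function.Injective tip := fun a b h => by
    simpa [tip, Fin.ext_iff] using h
  have hmiss : (Finset.univ.filter fun j => tip j ∉ S).card ≤ 1 := by
    rw [Finset.card_le_one]
    intro a ha b hb
    by_contra hab
    simp only [Finset.mem_filter, Finset.mem_univ, true_and] at ha hb
    obtain ⟨w, hw, hd⟩ := hS _ _ ha hb (htip.ne hab)
    apply hd
    -- Any vertex other than two sibling tips is equidistant from them.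
    have ha' : w ≠ tip a := by rintro rfl; exact ha hw
    have hb' : w ≠ tip b := by rintro rfl; exact hb hw
    rw [comb_edist hl, comb_edist hl]
    congr 1
    obtain ⟨⟨i', h', j'⟩, hx⟩ := w
    simp only [tip, ne_eq, Subtype.mk.injEq, Prod.mk.injEq] at ha' hb'
    simp only [tip, combDist]
    grind
  have hhit : (Finset.univ.filter fun j => tip j ∈ S).card ≤
      (S.filter fun x => x.1.1 = i).card := by
    apply Finset.card_le_card_of_injOn tip
    · intro j hj
      simpa [tip] using hj
    · exact htip.injOn
  have := Finset.card_filter_add_card_filter_not (s := (Finset.univ : Finset (Fin (t i))))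
    (fun j => tip j ∈ S)
  rw [Finset.card_univ, Fintype.card_fin] at this
  omega

/-- A dominating set meets each column that is high enough. -/
theorem comb_one_le_card_of_isDistDominatingSet (hl : ∀ i, 1 ≤ l i) (ht : ∀ i, 1 ≤ t i)
    {k : ℕ} {S : Finset (combVerts n l t)}
    (hS : (comb n l t).IsDistDominatingSet k S) {i : ℕ} (hi : i < n) (hk : k ≤ l i) :
    1 ≤ (S.filter fun x => x.1.1 = i).card := by
  have hm : (i, l i, 0) ∈ combVerts n l t := by
    have := ht i
    rw [mem_combVerts]; grind
  rw [Nat.one_le_iff_ne_zero, Finset.card_ne_zero]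
  by_cases h : (⟨_, hm⟩ : combVerts n l t) ∈ S
  · exact ⟨_, Finset.mem_filter.2 ⟨h, rfl⟩⟩
  · obtain ⟨x, hx, hd⟩ := hS _ h
    refine ⟨x, Finset.mem_filter.2 ⟨hx, ?_⟩⟩
    rw [comb_edist hl] at hd
    have hd : combDist (i, l i, 0) x ≤ k := by exact_mod_cast hd
    -- From the tip, leaving the column takes `l i` steps to the foot and at least one more.
    by_contra hne
    simp only [combDist] at hd
    rw [if_neg (Ne.symm hne)] at hd
    omega

/-- Columns partition the vertices, so lower bounds per column add up. -/
theorem comb_sum_le_card {S : Finset (combVerts n l t)} {f : ℕ → ℕ}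
    (h : ∀ i < n, f i ≤ (S.filter fun x => x.1.1 = i).card) :
    ∑ i ∈ Finset.range n, f i ≤ S.card := by
  rw [Finset.card_eq_sum_card_fiberwise (f := fun x : combVerts n l t => x.1.1)
    (t := Finset.range n)]
  · exact Finset.sum_le_sum fun i hi => h i (Finset.mem_range.1 hi)
  · rintro ⟨⟨i, h, j⟩, hx⟩ -
    simpa using (mem_combVerts.1 hx).1

/-- The vertices of the comb that lie in the given sets, one for each column. -/
def combSet (n : ℕ) (l t : ℕ → ℕ) (A : ℕ → Finset (ℕ × ℕ)) : Finset (combVerts n l t) :=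
  Finset.univ.filter fun x => x.1.2 ∈ A x.1.1

theorem mem_combSet {A : ℕ → Finset (ℕ × ℕ)} {x : combVerts n l t} :
    x ∈ combSet n l t A ↔ x.1.2 ∈ A x.1.1 := by simp [combSet]

theorem card_combSet_le (A : ℕ → Finset (ℕ × ℕ)) :
    (combSet n l t A).card ≤ ∑ i ∈ Finset.range n, (A i).card := by
  rw [← Finset.card_sigma]
  apply Finset.card_le_card_of_injOn (fun x => ⟨x.1.1, x.1.2⟩)
  · rintro ⟨⟨i, h, j⟩, hx⟩ hA
    simpa [(mem_combVerts.1 hx).1, mem_combSet] using hA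
  · rintro ⟨⟨i, h, j⟩, hx⟩ - ⟨⟨i', h', j'⟩, hy⟩ - h
    simpa using h

/-- A set containing a secondary tip in each extreme column, and all secondary tips, resolves. -/
theorem comb_isResolvingSet (hl : ∀ i, 1 ≤ l i) (hn : 2 ≤ n) (h0 : 2 ≤ t 0)
    (h1 : 2 ≤ t (n - 1)) {S : Finset (combVerts n l t)}
    (hS : ∀ x : combVerts n l t, x.1.2.2 ≠ 0 → x ∈ S) : (comb n l t).IsResolvingSet S := by
  have ha : (0, l 0, 1) ∈ combVerts n l t := by rw [mem_combVerts]; grind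
  have hb : (n - 1, l (n - 1), 1) ∈ combVerts n l t := by rw [mem_combVerts]; grind
  intro x y hx hy hxy
  by_contra! hcon
  have hda := hcon _ (hS ⟨_, ha⟩ one_ne_zero)
  have hdb := hcon _ (hS ⟨_, hb⟩ one_ne_zero)
  have hx := not_imp_comm.1 (hS x) hx
  have hy := not_imp_comm.1 (hS y) hy
  rw [comb_edist hl, comb_edist hl] at hda hdb
  replace hda := ENat.natCast_inj.1 hda
  replace hdb := ENat.natCast_inj.1 hdb
  clear hcon hS
  obtain ⟨⟨i, h, j⟩, hx'⟩ := x
  obtain ⟨⟨i', h', j'⟩, hy'⟩ := y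
  simp only at hx hy
  subst hx hy
  simp only [ne_eq, Subtype.mk.injEq, Prod.mk.injEq] at hxy
  rw [mem_combVerts] at hx' hy'
  have e1 := hl 0
  have e2 := hl (n - 1)
  have f1 : i = 0 → l i = l 0 := by rintro rfl; rfl
  have f2 : i = n - 1 → l i = l (n - 1) := by rintro rfl; rfl
  have f3 : i' = 0 → l i' = l 0 := by rintro rfl; rfl
  have f4 : i' = n - 1 → l i' = l (n - 1) := by rintro rfl; rfl
  -- For a vertex in an inner column, the sum of the two distances gives the height and their
  -- difference the column. In an extreme column, the distance to the opposite tip gives the height.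
  simp only [combDist] at hda hdb
  split_ifs at hda hdb <;> first | omega | grind

end

/-! ### The three parameters of a comb -/

section

variable {n : ℕ} {l t : ℕ → ℕ}

/-- A set meeting every column at its foot, or at a secondary tip, dominates. -/
theorem comb_isDistDominatingSet (hl : ∀ i, 1 ≤ l i) {k : ℕ} (hk : 2 ≤ k)
    (hlk : ∀ i, l i ≤ k) {S : Finset (combVerts n l t)}
    (hS : ∀ i < n, ∃ x ∈ S, x.1 = (i, 0, 0) ∨ x.1 = (i, l i, 1)) :
    (comb n l t).IsDistDominatingSet k S := by
  rintro ⟨⟨i, h, j⟩, hv⟩ -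
  have hv' := mem_combVerts.1 hv
  obtain ⟨x, hx, hxi⟩ := hS i hv'.1
  refine ⟨x, hx, ?_⟩
  rw [comb_edist hl]
  have := hl i
  have := hlk i
  norm_cast
  -- Sibling tips are at distance 2, whence `2 ≤ k`.
  rcases hxi with hxi | hxi <;> rw [hxi] <;> simp only [combDist] <;> grind

theorem comb_metricDim (hl : ∀ i, 1 ≤ l i) (hn : 2 ≤ n) (h0 : 2 ≤ t 0) (h1 : 2 ≤ t (n - 1)) :
    (comb n l t).metricDim = ∑ i ∈ Finset.range n, (t i - 1) := by
  refine sInf_card_eq ⟨combSet n l t fun i => {l i} ×ˢ Finset.Ico 1 (t i), ?_, ?_⟩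
    fun S hS => comb_sum_le_card fun i hi => comb_le_card_of_isResolvingSet hl hS hi
  · refine comb_isResolvingSet hl hn h0 h1 ?_
    rintro ⟨⟨i, h, j⟩, hx⟩ hj
    have := mem_combVerts.1 hx
    simp only [mem_combSet, Finset.mem_product, Finset.mem_singleton, Finset.mem_Ico]
    simp only at hj
    grind
  · refine (card_combSet_le _).trans (le_of_eq ?_)
    simp

/-- A comb is dominated by the feet of its high columns, if the other columns have height one
and are adjacent to a high one. -/
theorem comb_distDominationNumber (hl : ∀ i, 1 ≤ l i) (ht : ∀ i, 1 ≤ t i) {k : ℕ} (hk : 2 ≤ k)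
    (hlk : ∀ i < n, l i = k ∨
      l i = 1 ∧ ∃ i' < n, l i' = k ∧ (i' = i + 1 ∨ i = i' + 1)) :
    (comb n l t).distDominationNumber k =
      ∑ i ∈ Finset.range n, if l i = k then 1 else 0 := by
  refine sInf_card_eq ⟨combSet n l t fun i => if l i = k then {(0, 0)} else ∅, ?_, ?_⟩
    fun S hS => comb_sum_le_card fun i hi => ?_
  · have foot : ∀ i < n, (i, 0, 0) ∈ combVerts n l t := fun i hi => by
      have := hl i
      rw [mem_combVerts]; grind
    have hmem : ∀ i (hi : i < n), l i = k → (⟨(i, 0, 0), foot i hi⟩ : combVerts n l t) ∈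
        combSet n l t fun i => if l i = k then {(0, 0)} else ∅ := fun i hi hk => by
      simp [mem_combSet, hk]
    rintro ⟨⟨i, h, j⟩, hv⟩ -
    have hv' := mem_combVerts.1 hv
    rcases hlk i hv'.1 with hi | ⟨hi, i', hi', hik, hii⟩
    · refine ⟨_, hmem i hv'.1 hi, ?_⟩
      rw [comb_edist hl]
      norm_cast
      simp only [combDist]
      grind
    -- A tip of height one is two steps from the neighbouring foot, again within `k`.
    · refine ⟨_, hmem i' hi' hik, ?_⟩
      rw [comb_edist hl]
      norm_cast
      simp only [combDist]
      grind
  · refine (card_combSet_le _).trans (Finset.sum_le_sum fun i _ => ?_)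
    split_ifs <;> simp
  · split_ifs with h
    · exact comb_one_le_card_of_isDistDominatingSet hl ht hS hi h.ge
    · exact Nat.zero_le _

/-- With several tips, the `t i - 1` secondary ones already dominate their column; with a single
tip, the foot is added. -/
theorem comb_distResolvingDominationNumber (hl : ∀ i, 1 ≤ l i) (ht : ∀ i, 1 ≤ t i) (hn : 2 ≤ n)
    (h0 : 2 ≤ t 0) (h1 : 2 ≤ t (n - 1)) {k : ℕ} (hk : 2 ≤ k) (hlk : ∀ i, l i ≤ k)
    (hlt : ∀ i < n, l i = k ∨ 2 ≤ t i) :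
    (comb n l t).distResolvingDominationNumber k =
      ∑ i ∈ Finset.range n, max (t i - 1) 1 := by
  refine sInf_card_eq ⟨combSet n l t fun i =>
    if t i = 1 then {(0, 0)} else {l i} ×ˢ Finset.Ico 1 (t i), ⟨?_, ?_⟩, ?_⟩
    fun S hS => comb_sum_le_card fun i hi => ?_
  · refine comb_isResolvingSet hl hn h0 h1 ?_
    rintro ⟨⟨i, h, j⟩, hx⟩ hj
    have := mem_combVerts.1 hx
    simp only at hj
    rw [mem_combSet, if_neg (by grind)]
    simp only [Finset.mem_product, Finset.mem_singleton, Finset.mem_Ico]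
    grind
  · refine comb_isDistDominatingSet hl hk hlk fun i hi => ?_
    have := ht i
    have := hl i
    by_cases h : t i = 1
    · refine ⟨⟨(i, 0, 0), by rw [mem_combVerts]; grind⟩, ?_, Or.inl rfl⟩
      simp [mem_combSet, h]
    · refine ⟨⟨(i, l i, 1), by rw [mem_combVerts]; grind⟩, ?_, Or.inr rfl⟩
      rw [mem_combSet, if_neg h]
      simp only [Finset.mem_product, Finset.mem_singleton, Finset.mem_Ico]
      grind
  · refine (card_combSet_le _).trans (Finset.sum_le_sum fun i _ => ?_)
    split_ifs <;> simp
  · have h2 := comb_le_card_of_isResolvingSet hl hS.1 hi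
    refine max_le h2 ?_
    rcases hlt i hi with h | h
    · exact comb_one_le_card_of_isDistDominatingSet hl ht hS.2 hi h.ge
    · omega

end

/-! ### Paths: metric dimension one -/

/-- The combs with a single column and a single tip are the paths. -/
theorem path_isResolvingSet {L : ℕ} (hL : 1 ≤ L)
    {S : Finset (combVerts 1 (fun _ => L) (fun _ => 1))} {x : combVerts 1 (fun _ => L) (fun _ => 1)}
    (hx : x ∈ S) (hx0 : x.1 = (0, 0, 0)) :
    (comb 1 (fun _ => L) (fun _ => 1)).IsResolvingSet S := by
  rintro ⟨⟨i, h, j⟩, hu⟩ ⟨⟨i', h', j'⟩, hv⟩ - - huv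
  refine ⟨x, hx, ?_⟩
  rw [comb_edist fun _ => hL, comb_edist fun _ => hL, hx0]
  rw [mem_combVerts] at hu hv
  simp only [ne_eq, Subtype.mk.injEq, Prod.mk.injEq] at huv
  norm_cast
  simp only [combDist]
  grind

theorem path_mem {L h : ℕ} (hh : h ≤ L) :
    (0, h, 0) ∈ combVerts 1 (fun _ => L) (fun _ => 1) := by
  rw [mem_combVerts]; grind

theorem path_eq {L : ℕ} (x : combVerts 1 (fun _ => L) (fun _ => 1)) :
    x.1.1 = 0 ∧ x.1.2.1 ≤ L ∧ x.1.2.2 = 0 := by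
  obtain ⟨⟨i, h, j⟩, hx⟩ := x
  rw [mem_combVerts] at hx
  grind

theorem path_card_pos_of_isResolvingSet {L : ℕ} (hL : 1 ≤ L)
    {S : Finset (combVerts 1 (fun _ => L) (fun _ => 1))}
    (hS : (comb 1 (fun _ => L) (fun _ => 1)).IsResolvingSet S) : 1 ≤ S.card := by
  by_contra hc
  obtain rfl : S = ∅ := Finset.card_eq_zero.1 (by omega)
  obtain ⟨w, hw, -⟩ := hS ⟨_, path_mem (Nat.zero_le L)⟩ ⟨_, path_mem hL⟩ (by simp) (by simp)
    (by simp)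
  simp at hw

theorem path_metricDim {L : ℕ} (hL : 1 ≤ L) :
    (comb 1 (fun _ => L) (fun _ => 1)).metricDim = 1 :=
  sInf_card_eq ⟨{⟨_, path_mem (Nat.zero_le L)⟩},
    path_isResolvingSet hL (Finset.mem_singleton_self _) rfl, by simp⟩
    fun _ hS => path_card_pos_of_isResolvingSet hL hS

/-- Balls of radius `k` around every `2 * k + 1`-th vertex are disjoint. -/
theorem path_le_card_of_isDistDominatingSet {k L m : ℕ} (hL : 1 ≤ L)
    (hm : (2 * k + 1) * (m - 1) ≤ L)
    {S : Finset (combVerts 1 (fun _ => L) (fun _ => 1))}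
    (hS : (comb 1 (fun _ => L) (fun _ => 1)).IsDistDominatingSet k S) : m ≤ S.card := by
  have hmem : ∀ i : Fin m, (2 * k + 1) * i ≤ L := fun i =>
    (Nat.mul_le_mul_left _ (by omega)).trans hm
  have hS' : ∀ i : Fin m, ∃ x ∈ S, combDist (0, (2 * k + 1) * i, 0) x.1 ≤ k := fun i => by
    by_cases h : (⟨_, path_mem (hmem i)⟩ : combVerts 1 (fun _ => L) (fun _ => 1)) ∈ S
    · exact ⟨_, h, by simp [combDist]⟩
    · obtain ⟨x, hx, hd⟩ := hS _ h
      rw [comb_edist fun _ => hL] at hd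
      exact ⟨x, hx, by exact_mod_cast hd⟩
  choose f hf hd using hS'
  have hinj : Function.Injective f := fun a b hab => by
    have ha := hd a
    have hb := hd b
    rw [combDist_comm] at hb
    rw [← hab] at hb
    have h := (combDist_triangle _ _ _).trans (Nat.add_le_add ha hb)
    by_contra hne
    have hne' : (a : ℕ) ≠ b := fun h => hne (Fin.ext h)
    simp only [combDist] at h
    rcases Nat.lt_or_gt_of_ne hne' with hlt | hlt
    · have := Nat.mul_le_mul_left (2 * k + 1) hlt
      rw [Nat.mul_succ] at this
      split_ifs at h <;> omega
    · have := Nat.mul_le_mul_left (2 * k + 1) hlt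
      rw [Nat.mul_succ] at this
      split_ifs at h <;> omega
  have := Finset.card_le_card_of_injOn (s := Finset.univ) f (fun i _ => hf i) hinj.injOn
  simpa using this

theorem exists_tree_of_metricDim_eq_one {k m : ℕ} (hk : 1 ≤ k) (hm : 1 ≤ m) :
    ∃ (V : Type) (_ : Finite V) (T : SimpleGraph V), T.IsTree ∧
      T.metricDim = 1 ∧ T.distDominationNumber k = m ∧
      T.distResolvingDominationNumber k = m := by
  -- The multiples of `2 * k + 1` form a minimum dominating set containing the end 0, which
  -- resolves. The extra vertex avoids the one-vertex path, of dimension 0, when `m = 1`.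
  have hL : 1 ≤ (2 * k + 1) * (m - 1) + 1 := by omega
  let S := combSet 1 (fun _ => (2 * k + 1) * (m - 1) + 1) (fun _ => 1)
    fun _ => (Finset.range m).image fun i => ((2 * k + 1) * i, 0)
  have hcard : S.card ≤ m := by
    refine (card_combSet_le _).trans ?_
    simpa using (Finset.card_image_le (s := Finset.range m) (f := fun i => ((2 * k + 1) * i, 0)))
  have hdom : (comb 1 (fun _ => (2 * k + 1) * (m - 1) + 1) (fun _ => 1)).IsDistDominatingSet
      k S := by
    intro v _
    obtain ⟨h1, h2, h3⟩ := path_eq v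
    -- Adding `k` before dividing rounds to the nearest multiple.
    obtain ⟨q, hq, hd⟩ : ∃ q < m, combDist v (0, (2 * k + 1) * q, 0) ≤ k := by
      have hdm := Nat.div_add_mod (v.1.2.1 + k) (2 * k + 1)
      have hmod := Nat.mod_lt (v.1.2.1 + k) (show 0 < 2 * k + 1 by omega)
      have hlt : (v.1.2.1 + k) / (2 * k + 1) < m := by
        rw [Nat.div_lt_iff_lt_mul (by omega)]
        have hsucc := Nat.mul_succ (2 * k + 1) (m - 1)
        rw [Nat.succ_eq_add_one, Nat.sub_add_cancel hm] at hsucc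
        rw [Nat.mul_comm m]
        omega
      refine ⟨_, hlt, ?_⟩
      simp only [combDist]
      split_ifs <;> omega
    have hmem := path_mem (h := (2 * k + 1) * q) (L := (2 * k + 1) * (m - 1) + 1)
      ((Nat.mul_le_mul_left _ (by omega)).trans (Nat.le_succ _))
    refine ⟨⟨_, hmem⟩, ?_, ?_⟩
    · rw [mem_combSet]
      exact Finset.mem_image.2 ⟨q, Finset.mem_range.2 hq, rfl⟩
    · rw [comb_edist fun _ => hL]
      exact_mod_cast hd
  have hlow : ∀ D, (comb 1 (fun _ => (2 * k + 1) * (m - 1) + 1) (fun _ => 1)).IsDistDominatingSet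
      k D → m ≤ D.card := fun D hD =>
    path_le_card_of_isDistDominatingSet hL (Nat.le_succ _) hD
  have hzero : (⟨_, path_mem (Nat.zero_le _)⟩ : combVerts 1 _ _) ∈ S :=
    mem_combSet.2 (Finset.mem_image.2 ⟨0, Finset.mem_range.2 hm, rfl⟩)
  exact ⟨_, inferInstance, comb 1 (fun _ => (2 * k + 1) * (m - 1) + 1) (fun _ => 1),
    comb_isTree (fun _ => hL) le_rfl, path_metricDim hL, sInf_card_eq ⟨S, hdom, hcard⟩ hlow,
    sInf_card_eq ⟨S, ⟨path_isResolvingSet hL hzero rfl, hdom⟩, hcard⟩ fun D hD => hlow D hD.2⟩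

theorem exists_tree_one_one_two {k : ℕ} (hk : 1 ≤ k) :
    ∃ (V : Type) (_ : Finite V) (T : SimpleGraph V), T.IsTree ∧
      T.metricDim = 1 ∧ T.distDominationNumber k = 1 ∧
      T.distResolvingDominationNumber k = 2 := by
  have hL : 1 ≤ 2 * k := by omega
  let c : combVerts 1 (fun _ => 2 * k) (fun _ => 1) :=
    ⟨_, path_mem (h := k) (L := 2 * k) (by omega)⟩
  let a : combVerts 1 (fun _ => 2 * k) (fun _ => 1) := ⟨_, path_mem (Nat.zero_le (2 * k))⟩
  let b : combVerts 1 (fun _ => 2 * k) (fun _ => 1) := ⟨_, path_mem (le_refl (2 * k))⟩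
  have hdom : ∀ S, c ∈ S → (comb 1 (fun _ => 2 * k) (fun _ => 1)).IsDistDominatingSet k S := by
    intro S hc v _
    obtain ⟨h1, h2, h3⟩ := path_eq v
    refine ⟨c, hc, ?_⟩
    rw [comb_edist fun _ => hL]
    norm_cast
    simp only [combDist, c]
    split_ifs <;> omega
  refine ⟨_, inferInstance, comb 1 (fun _ => 2 * k) (fun _ => 1),
    comb_isTree (fun _ => hL) le_rfl, path_metricDim hL,
    sInf_card_eq ⟨{c}, hdom _ (by simp), by simp⟩ fun D hD =>
      path_le_card_of_isDistDominatingSet hL (by simp) hD,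
    sInf_card_eq ⟨{a, c}, ⟨path_isResolvingSet hL (x := a) (by simp) rfl, hdom _ (by simp)⟩,
      Finset.card_le_two⟩ fun D hD => ?_⟩
  by_contra hlt
  have hpos := path_card_pos_of_isResolvingSet hL hD.1
  obtain ⟨w, rfl⟩ := Finset.card_eq_one.1 (show D.card = 1 by omega)
  obtain ⟨h1, h2, h3⟩ := path_eq w
  have hw : ∀ v : combVerts 1 (fun _ => 2 * k) (fun _ => 1), combDist v w.1 ≤ k := by
    intro v
    by_cases hv : v = w
    · rw [hv, combDist_self]; omega
    · obtain ⟨x, hx, hd⟩ := hD.2 v (by simpa using hv)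
      rw [Finset.mem_singleton.1 hx, comb_edist fun _ => hL] at hd
      exact_mod_cast hd
  have hwa := hw a
  have hwb := hw b
  -- Only the midpoint is within `k` of both ends, and it does not separate them.
  have hwk : w.1.2.1 = k := by
    simp only [combDist, a, b] at hwa hwb
    split_ifs at hwa hwb <;> omega
  have hne : ∀ v : combVerts 1 (fun _ => 2 * k) (fun _ => 1), v.1.2.1 ≠ k →
      v ∉ ({w} : Finset _) := by
    intro v hv hvw
    rw [Finset.mem_singleton.1 hvw] at hv
    exact hv hwk
  obtain ⟨x, hx, hd⟩ := hD.1 a b (hne a (by simp [a]; omega)) (hne b (by simp [b]; omega))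
    (by simp [a, b]; omega)
  apply hd
  rw [Finset.mem_singleton.1 hx, comb_edist fun _ => hL, comb_edist fun _ => hL]
  congr 1
  simp only [combDist, a, b]
  split_ifs <;> omega

/-! ### Realizing the triples with `β ≥ 2` -/

theorem sum_range_two_blocks {p q c d : ℕ} {f : ℕ → ℕ} (hp : ∀ i < p, f i = c)
    (hq : ∀ i < q, f (p + i) = d) :
    ∑ i ∈ Finset.range (p + q + 1), f i = p * c + q * d + f (p + q) := by
  rw [Finset.sum_range_succ, Finset.sum_range_add,
    Finset.sum_congr rfl fun i hi => hp i (Finset.mem_range.1 hi),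
    Finset.sum_congr rfl fun i hi => hq i (Finset.mem_range.1 hi)]
  simp

theorem exists_tree_of_two_le_metricDim {k b g a : ℕ} (hk : 2 ≤ k) (hb : 2 ≤ b) (hg : 1 ≤ g)
    (hga : g ≤ a) (hba : b ≤ a) (hab : a ≤ g + b) :
    ∃ (V : Type) (_ : Finite V) (T : SimpleGraph V), T.IsTree ∧
      T.metricDim = b ∧ T.distDominationNumber k = g ∧
      T.distResolvingDominationNumber k = a := by
  suffices h : ∃ (n : ℕ) (l t : ℕ → ℕ), 2 ≤ n ∧ 2 ≤ t 0 ∧ 2 ≤ t (n - 1) ∧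
      (∀ i, 1 ≤ l i) ∧ (∀ i, 1 ≤ t i) ∧ (∀ i, l i ≤ k) ∧
      (∀ i < n, l i = k ∨
        l i = 1 ∧ 2 ≤ t i ∧ ∃ i' < n, l i' = k ∧ (i' = i + 1 ∨ i = i' + 1)) ∧
      ∑ i ∈ Finset.range n, (t i - 1) = b ∧
      (∑ i ∈ Finset.range n, if l i = k then 1 else 0) = g ∧
      ∑ i ∈ Finset.range n, max (t i - 1) 1 = a by
    obtain ⟨n, l, t, hn, h0, h1, hl, ht, hlk, hlt, rfl, rfl, rfl⟩ := h
    refine ⟨_, inferInstance, comb n l t, comb_isTree hl (by omega),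
      comb_metricDim hl hn h0 h1, comb_distDominationNumber hl ht hk fun i hi => ?_,
      comb_distResolvingDominationNumber hl ht hn h0 h1 hk hlk fun i hi => ?_⟩
    · rcases hlt i hi with h | ⟨h, -, h'⟩
      exacts [Or.inl h, Or.inr ⟨h, h'⟩]
    · rcases hlt i hi with h | ⟨-, h, -⟩
      exacts [Or.inl h, Or.inr h]
  obtain ⟨s, hs⟩ : ∃ s, g + b = a + s := Nat.exists_eq_add_of_le hab
  -- Here `s` is the number of columns of height `k` with several tips. Both extreme columns need
  -- several tips, so height-one columns fill in when `s < 2`.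
  obtain _ | _ | s := s
  · refine ⟨1 + g + 1, fun i => if i = 0 ∨ i = 1 + g then 1 else k,
      fun i => if i = 0 then 2 else if i = 1 + g then b else 1, by omega, by simp, by grind,
      by grind, by grind, by grind, fun i hi => ?_, ?_, ?_, ?_⟩
    · by_cases h : i = 0
      · exact Or.inr ⟨by grind, by grind, 1, by grind⟩
      · by_cases h' : i = 1 + g
        · exact Or.inr ⟨by grind, by grind, g, by grind⟩
        · exact Or.inl (by grind)
    · rw [sum_range_two_blocks (c := 1) (d := 0)] <;> grind
    · rw [sum_range_two_blocks (c := 0) (d := 1)] <;> grind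
    · rw [sum_range_two_blocks (c := 1) (d := 1)] <;> grind
  · refine ⟨1 + (g - 1) + 1, fun i => if i = 0 then 1 else k,
      fun i => if i = 0 then 2 else if i = g then b else 1, by omega, by simp, by grind,
      by grind, by grind, by grind, fun i hi => ?_, ?_, ?_, ?_⟩
    · by_cases h : i = 0
      · exact Or.inr ⟨by grind, by grind, 1, by grind⟩
      · exact Or.inl (by grind)
    · rw [sum_range_two_blocks (c := 1) (d := 0)] <;> grind
    · rw [sum_range_two_blocks (c := 0) (d := 1)] <;> grind
    · rw [sum_range_two_blocks (c := 1) (d := 1)] <;> grind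
  -- The number is now `s + 2`: the first `s + 1` columns and the last, whose `b - s` tips bring the
  -- dimension to `b`. The bounds `b ≤ a` and `g ≤ a` give `s + 2 ≤ g` and `2 ≤ b - s`.
  · refine ⟨s + 1 + (g - (s + 2)) + 1, fun _ => k,
      fun i => if i < s + 1 then 2 else if i = g - 1 then b - s else 1, by omega, by simp,
      by grind, by grind, by grind, by grind, fun i hi => Or.inl rfl, ?_, ?_, ?_⟩
    · rw [sum_range_two_blocks (c := 1) (d := 0)] <;> grind
    · rw [sum_range_two_blocks (c := 1) (d := 1)] <;> grind
    · rw [sum_range_two_blocks (c := 1) (d := 1)] <;> grind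

theorem mainTheorem2 (k : ℕ) (hk : 2 ≤ k) :
    (∀ β γ α : ℕ, 0 < β → 0 < γ → 0 < α → max γ β ≤ α → α ≤ γ + β →
      ¬ (β = 1 ∧ 2 ≤ γ ∧ α = γ + 1) →
      ∃ (V : Type) (_ : Finite V) (T : SimpleGraph V), T.IsTree ∧
        T.metricDim = β ∧ T.distDominationNumber k = γ ∧
        T.distResolvingDominationNumber k = α) ∧
    (∀ γ : ℕ, 2 ≤ γ →
      ¬ ∃ (V : Type*) (_ : Finite V) (G : SimpleGraph V), G.Connected ∧
        G.metricDim = 1 ∧ G.distDominationNumber k = γ ∧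
        G.distResolvingDominationNumber k = γ + 1) := by
  constructor
  · intro b g a hb hg _ hmax hab hexc
    obtain ⟨hga, hba⟩ := max_le_iff.1 hmax
    rcases Nat.lt_or_ge b 2 with h | h
    · obtain rfl : b = 1 := by omega
      rcases Nat.lt_or_ge g a with h' | h'
      · obtain rfl : g = 1 := by omega
        obtain rfl : a = 2 := by omega
        exact exists_tree_one_one_two (by omega)
      · obtain rfl : g = a := by omega
        exact exists_tree_of_metricDim_eq_one (by omega) hg
    · exact exists_tree_of_two_le_metricDim hk h hg hga hba hab
  · rintro g hg ⟨V, _, G, hG, h1, rfl, h3⟩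
    have := hG.distResolvingDominationNumber_le_of_metricDim_eq_one h1 hg
    omega
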